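/- Let $\gamma\ge 1$, $\mu>0$, $k>0$. For $\epsilon>0$ consider the quantum hydrodynamics (QHD) system with linear viscosity $$\rho_t+m_x=0,\qquad m_t+\Big(\frac{m^2}{\rho}+\rho^\gamma\Big)_x=\epsilon\mu\, m_{xx}+\epsilon^2k^2\rho\Big(\frac{(\sqrt\rho)_{xx}}{\sqrt\rho}\Big)_x ,$$ and the underlying Euler system $\rho_t+m_x=0$, $m_t+\big(\frac{m^2}{\rho}+\rho^\gamma\big)_x=0$, whose characteristic speeds at a state $w=(\rho,m)$ with $\rho>0$ are $\lambda_1(w)=u-c_s(\rho)$ and $\lambda_2(w)=u+c_s(\rho)$, where $u=m/\rho$ and $c_s(\rho)=\sqrt{\gamma\rho^{\gamma-1}}$. The state $w$ is subsonic if $|u|<c_s(\rho)$. Let $w^\pm=[P^\pm,J^\pm]$ with $P^\pm>0$ and $s\in\mathbb R$. The triple $(w^\pm;s)$ is a Lax $j$-shock ($j=1,2$) if it satisfies the Rankine–Hugoniot conditions $$J^+-J^-=s(P^+-P^-),\qquad \Big(\frac{J^2}{P}+P^\gamma\Big)^+-\Big(\frac{J^2}{P}+P^\gamma\Big)^-=s(J^+-J^-)$$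 and $\lambda_j(w^+)<s<\lambda_j(w^-)$. Suppose that $(w^\pm;s)$ is either (i) a Lax 2-shock with a subsonic right state $w^+$, or (ii) a Lax 1-shock with a subsonic left state $w^-$. Then there exists a traveling wave profile with speed $s$ connecting $[P^-,J^-]$ to $[P^+,J^+]$: there are functions $P,J:\mathbb R\to\mathbb R$ with $P>0$, independent of $\epsilon$, such that for every $\epsilon>0$ the functions $\rho(t,x)=P\big(\frac{x-st}{\epsilon}\big)$, $m(t,x)=J\big(\frac{x-st}{\epsilon}\big)$ form a classical solution ($\rho\in C^3$, $m\in C^2$) of the QHD system on $\mathbb R\times\mathbb R$, and $$\lim_{y\to\pm\infty}P(y)=P^\pm,\qquad \lim_{y\to\pm\infty}J(y)=J^\pm,\qquad \lim_{y\to\pm\infty}P'(y)=0 .$$ -/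

import Mathlib

open Filter Topology

namespace QHD

noncomputable section

/-- Partial derivative in time of `f = f(t, x)`. -/
def dt (f : ℝ → ℝ → ℝ) : ℝ → ℝ → ℝ := fun t x => deriv (fun τ => f τ x) t

/-- Partial derivative in space of `f = f(t, x)`. -/
def dx (f : ℝ → ℝ → ℝ) : ℝ → ℝ → ℝ := fun t x => deriv (fun y => f t y) x

/-- The pressure `p(ρ) = ρ ^ γ`. -/
def pressure (γ ρ : ℝ) : ℝ := ρ ^ γ

/-- The Bohm potential `(√ρ)_xx / √ρ`. -/
def bohm (ρ : ℝ → ℝ → ℝ) : ℝ → ℝ → ℝ :=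
  fun t x => dx (dx (fun τ y => √(ρ τ y))) t x / √(ρ t x)

/-- `(ρ, m)` is a classical solution with positive density, on all of `ℝ × ℝ`, of the
quantum hydrodynamics system with linear viscosity
`ρ_t + m_x = 0`,
`m_t + (m² / ρ + p(ρ))_x = ε μ m_xx + ε² k² ρ ((√ρ)_xx / √ρ)_x`. -/
structure IsSolution (γ μ k ε : ℝ) (ρ m : ℝ → ℝ → ℝ) : Prop where
  contDiff_density : ContDiff ℝ 3 (fun z : ℝ × ℝ => ρ z.1 z.2)
  contDiff_momentum : ContDiff ℝ 2 (fun z : ℝ × ℝ => m z.1 z.2)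
  density_pos : ∀ t x, 0 < ρ t x
  mass : ∀ t x, dt ρ t x + dx m t x = 0
  momentum : ∀ t x,
    dt m t x + dx (fun τ y => (m τ y) ^ 2 / ρ τ y + pressure γ (ρ τ y)) t x =
      ε * μ * dx (dx m) t x + ε ^ 2 * k ^ 2 * ρ t x * dx (bohm ρ) t x

/-- The function `(t, x) ↦ P ((x - s t) / ε)`. -/
def travelingWave (s ε : ℝ) (P : ℝ → ℝ) : ℝ → ℝ → ℝ := fun t x => P ((x - s * t) / ε)

/-- `(P, J)` is a profile, of speed `s`, of traveling waves of the linearly viscous QHD system,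
and it connects the left state `w₁ = [P⁻, J⁻]` to the right state `w₂ = [P⁺, J⁺]`.
The profile does not depend on the scaling parameter `ε`. In the phase plane, `(P, P')` goes
from `[P⁻, 0]` to `[P⁺, 0]`. -/
structure IsTravelingWaveProfile (γ μ k s : ℝ) (w₁ w₂ : ℝ × ℝ) (P J : ℝ → ℝ) : Prop where
  isSolution : ∀ ε : ℝ, 0 < ε →
    IsSolution γ μ k ε (travelingWave s ε P) (travelingWave s ε J)
  tendsto_density_left : Tendsto P atBot (𝓝 w₁.1)
  tendsto_density_right : Tendsto P atTop (𝓝 w₂.1)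
  tendsto_momentum_left : Tendsto J atBot (𝓝 w₁.2)
  tendsto_momentum_right : Tendsto J atTop (𝓝 w₂.2)
  tendsto_deriv_left : Tendsto (deriv P) atBot (𝓝 0)
  tendsto_deriv_right : Tendsto (deriv P) atTop (𝓝 0)

/-- The Rankine–Hugoniot conditions of the Euler system
`ρ_t + m_x = 0`, `m_t + (m² / ρ + ρ ^ γ)_x = 0`
for the left state `w₁`, the right state `w₂` (states are pairs `w = (ρ, m)`) and the
speed `s`. -/
structure RankineHugoniot (γ s : ℝ) (w₁ w₂ : ℝ × ℝ) : Prop where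
  mass : w₂.2 - w₁.2 = s * (w₂.1 - w₁.1)
  momentum : (w₂.2 ^ 2 / w₂.1 + pressure γ w₂.1) - (w₁.2 ^ 2 / w₁.1 + pressure γ w₁.1) =
    s * (w₂.2 - w₁.2)

/-- The flow velocity `u = m / ρ` of the state `w = (ρ, m)`. -/
def velocity (w : ℝ × ℝ) : ℝ := w.2 / w.1

/-- The sound speed `c_s(ρ) = √(γ ρ ^ (γ - 1))`. -/
def soundSpeed (γ ρ : ℝ) : ℝ := √(γ * ρ ^ (γ - 1))

/-- The first characteristic speed (eigenvalue of the Jacobian) of the Euler system. -/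
def charSpeed₁ (γ : ℝ) (w : ℝ × ℝ) : ℝ := velocity w - soundSpeed γ w.1

/-- The second characteristic speed (eigenvalue of the Jacobian) of the Euler system. -/
def charSpeed₂ (γ : ℝ) (w : ℝ × ℝ) : ℝ := velocity w + soundSpeed γ w.1

/-- The discontinuity with left state `w₁`, right state `w₂` and speed `s` is a Lax 1-shock. -/
structure IsLax1Shock (γ s : ℝ) (w₁ w₂ : ℝ × ℝ) : Prop where
  rankineHugoniot : RankineHugoniot γ s w₁ w₂
  right_lt : charSpeed₁ γ w₂ < s
  lt_left : s < charSpeed₁ γ w₁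

/-- The discontinuity with left state `w₁`, right state `w₂` and speed `s` is a Lax 2-shock. -/
structure IsLax2Shock (γ s : ℝ) (w₁ w₂ : ℝ × ℝ) : Prop where
  rankineHugoniot : RankineHugoniot γ s w₁ w₂
  right_lt : charSpeed₂ γ w₂ < s
  lt_left : s < charSpeed₂ γ w₁

/-- The state `w = (ρ, m)` is subsonic: `|u| < c_s(ρ)`. -/
def IsSubsonic (γ : ℝ) (w : ℝ × ℝ) : Prop := |velocity w| < soundSpeed γ w.1

end

end QHD

namespace QHD

open Set Metric
open scoped NNReal

/-! Mass conservation makes the relative flux `A = s * P - J` constant along a profile. With `P =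
exp θ`, the Bohm term multiplied by `P` is half the derivative of `P * θ''` (up to `k ^ 2`), so the
momentum equation integrates once. Division by `P` then gives a damped oscillator with linear
friction, `θ'' = g(θ) - (2 * μ * s / k ^ 2) * θ'`, where `g = profileForce γ k A B`. By
Rankine–Hugoniot the same constant `B` serves both end states, so `g` vanishes at both. Up to a
positive factor `g` is a strictly convex function: it is negative between its zeros and positive to
the left of the smaller one. The larger density is thus a saddle and the smaller one a sink when
friction is positive. The Lax inequalities order the densities and the subsonic condition fixes the
sign of `s`; a 1-shock becomes the same problem after reversing time.

The heteroclinic orbit (`exists_heteroclinic`) is built from a point `m` between the equilibria.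
Shooting on the initial velocity in the time-reversed, anti-damped system yields an orbit that
increases to the saddle (`exists_trapped_orbit`, `IsOsc.tendsto_saddle`). Strict energy monotonicity
puts its starting point below the saddle's energy level. The forward damped orbit from that point
therefore cannot leave the potential well, and dissipation with Barbalat's lemma drives it to the
sink (`IsOsc.tendsto_sink`). Force and velocity are truncated so that flows are global; the orbit
stays where the truncations are inactive. -/

/-! ### Global flows, a comparison principle and Barbalat's lemma. -/

/-- A bounded Lipschitz vector field has global integral curves. -/
theorem exists_global_integralCurve {E : Type*} [NormedAddCommGroup E] [NormedSpace ℝ E]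
    [CompleteSpace E] {F : E → E} {K L : ℝ≥0} (hF : LipschitzWith K F) (hL : ∀ x, ‖F x‖ ≤ L)
    (x₀ : E) : ∃ f : ℝ → E, f 0 = x₀ ∧ ∀ t, HasDerivAt f (F (f t)) t := by
  have hlocal : ∀ n : ℕ, ∃ f : ℝ → E, f 0 = x₀ ∧
      ∀ t ∈ Ioo (-((n : ℝ) + 1)) ((n : ℝ) + 1), HasDerivAt f (F (f t)) t := by
    intro n
    have h0 : (0 : ℝ) ∈ Icc (-((n : ℝ) + 1)) ((n : ℝ) + 1) := by
      constructor <;> linarith [(Nat.cast_nonneg n : (0 : ℝ) ≤ n)]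
    have hPL : IsPicardLindelof (fun _ => F) (⟨0, h0⟩ : Icc (-((n : ℝ) + 1)) ((n : ℝ) + 1)) x₀
        (L * (n + 1)) 0 L K :=
      IsPicardLindelof.of_time_independent (fun x _ => hL x) hF.lipschitzOnWith (by simp)
    obtain ⟨f, hf0, hf⟩ := hPL.exists_eq_forall_mem_Icc_hasDerivWithinAt₀
    exact ⟨f, hf0, fun t ht =>
      (hf t (Ioo_subset_Icc_self ht)).hasDerivAt (Icc_mem_nhds ht.1 ht.2)⟩
  choose f hf0 hf using hlocal
  have hagree : ∀ n m : ℕ, n ≤ m → EqOn (f n) (f m) (Ioo (-((n : ℝ) + 1)) ((n : ℝ) + 1)) := by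
    intro n m hnm
    have hnm' : (n : ℝ) ≤ m := Nat.cast_le.2 hnm
    refine ODE_solution_unique_of_mem_Ioo (v := fun _ => F) (s := fun _ => univ) (K := K) (t₀ := 0)
      (fun _ _ => hF.lipschitzOnWith) ?_ (fun t ht => ⟨hf n t ht, mem_univ _⟩)
      (fun t ht => ⟨hf m t ⟨?_, ?_⟩, mem_univ _⟩) ((hf0 n).trans (hf0 m).symm)
    · constructor <;> linarith [(Nat.cast_nonneg n : (0 : ℝ) ≤ n)]
    · linarith [ht.1]
    · linarith [ht.2]
  -- The extra `1` places `t` strictly inside the interval with index `⌈|t|⌉₊`, so the glued curve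
  -- has a two-sided derivative there.
  have hmem : ∀ t : ℝ, t ∈ Ioo (-((⌈|t|⌉₊ : ℝ) + 1)) ((⌈|t|⌉₊ : ℝ) + 1) := fun t => by
    have := Nat.le_ceil |t|
    exact ⟨by linarith [neg_abs_le t], by linarith [le_abs_self t]⟩
  refine ⟨fun t => f ⌈|t|⌉₊ t, by simpa using hf0 0, fun t => ?_⟩
  refine (hf _ t (hmem t)).congr_of_eventuallyEq ?_
  filter_upwards [Ioo_mem_nhds (hmem t).1 (hmem t).2] with s hs
  rcases le_total ⌈|s|⌉₊ ⌈|t|⌉₊ with h | h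
  · exact hagree _ _ h (hmem s)
  · exact (hagree _ _ h hs).symm

/-- The flow of a Lipschitz vector field depends Lipschitz continuously on the initial value. -/
theorem lipschitzWith_flow {E : Type*} [NormedAddCommGroup E] [NormedSpace ℝ E] {F : E → E}
    {K : ℝ≥0} (hF : LipschitzWith K F) {X : E → ℝ → E} (hX0 : ∀ x, X x 0 = x)
    (hX : ∀ x t, HasDerivAt (X x) (F (X x t)) t) {t : ℝ} (ht : 0 ≤ t) :
    LipschitzWith (Real.exp (K * t)).toNNReal (fun x => X x t) := by
  refine LipschitzWith.of_dist_le_mul fun x y => ?_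
  have := dist_le_of_trajectories_ODE (v := fun _ => F) (fun _ => hF) (a := 0) (b := t)
    (fun s _ => (hX x s).continuousAt.continuousWithinAt) (fun s _ => (hX x s).hasDerivWithinAt)
    (fun s _ => (hX y s).continuousAt.continuousWithinAt) (fun s _ => (hX y s).hasDerivWithinAt)
    (δ := dist x y) (by rw [hX0, hX0]) t ⟨ht, le_rfl⟩
  rwa [sub_zero, mul_comm, ← Real.coe_toNNReal (Real.exp (K * t)) (Real.exp_pos _).le] at this

/-- A function that decreases as long as it stays below `c` and starts below `c` remains below its
initial value. -/
theorem le_initial_of_deriv_nonpos_below {f f' : ℝ → ℝ} {t₀ c : ℝ}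
    (hf : ∀ t, t₀ ≤ t → HasDerivAt f (f' t) t) (h : ∀ t, t₀ ≤ t → f t < c → f' t ≤ 0)
    (h₀ : f t₀ < c) {t : ℝ} (ht : t₀ ≤ t) : f t ≤ f t₀ := by
  refine le_of_forall_pos_le_add fun δ hδ => ?_
  -- Comparison with a line of small positive slope; rising by at most half the gap keeps that line
  -- below `c`, where the sign of `f'` is known.
  set δ' := min δ ((c - f t₀) / 2) with hδ'
  have hδ'0 : 0 < δ' := lt_min hδ (by linarith)
  have hδ'c : δ' ≤ (c - f t₀) / 2 := min_le_right _ _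
  have hpos : 0 < t - t₀ + 1 := by linarith
  have key := image_le_of_deriv_right_lt_deriv_boundary (f := f) (f' := f') (a := t₀) (b := t)
    (B := fun x => f t₀ + δ' / (t - t₀ + 1) * (x - t₀)) (B' := fun _ => δ' / (t - t₀ + 1))
    (fun x hx => (hf x hx.1).continuousAt.continuousWithinAt)
    (fun x hx => (hf x hx.1).hasDerivWithinAt) (by simp)
    (fun x => by
      simpa using (((hasDerivAt_id x).sub_const t₀).const_mul (δ' / (t - t₀ + 1))).const_add (f t₀))
    (fun x hx hxB => by
      refine (h x hx.1 ?_).trans_lt (by positivity)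
      rw [hxB]
      have : δ' / (t - t₀ + 1) * (x - t₀) ≤ δ' / (t - t₀ + 1) * (t - t₀ + 1) := by
        gcongr; linarith [hx.2]
      rw [div_mul_cancel₀ _ hpos.ne'] at this
      linarith) ⟨ht, le_rfl⟩
  have : δ' / (t - t₀ + 1) * (t - t₀) ≤ δ' / (t - t₀ + 1) * (t - t₀ + 1) := by
    gcongr; linarith
  rw [div_mul_cancel₀ _ hpos.ne'] at this
  have hm : δ' ≤ δ := min_le_left _ _
  linarith

/-- **Barbalat's lemma** for Lipschitz derivatives. -/
theorem tendsto_zero_of_lipschitz_deriv {f h : ℝ → ℝ} {c : ℝ} {K : ℝ≥0}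
    (hf : ∀ t, 0 ≤ t → HasDerivAt f (h t) t) (hh : LipschitzWith K h)
    (hc : Tendsto f atTop (𝓝 c)) : Tendsto h atTop (𝓝 0) := by
  rw [Metric.tendsto_atTop] at hc ⊢
  intro ε hε
  set δ : ℝ := ε / (2 * (K + 1)) with hδ
  have hK : (0 : ℝ) ≤ K := K.2
  have hδ0 : 0 < δ := by positivity
  have hKδ : K * δ ≤ ε / 2 := by
    rw [hδ, ← mul_div_assoc, div_le_div_iff₀ (by positivity) two_pos]
    nlinarith
  -- This tolerance makes the difference quotient over length `δ` at most `ε / 4`, while `h` varies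
  -- by at most `K * δ ≤ ε / 2` over that length.
  obtain ⟨N, hN⟩ := hc (δ * ε / 8) (by positivity)
  refine ⟨max N 0, fun t ht => ?_⟩
  have htN : N ≤ t := (le_max_left _ _).trans ht
  have ht0 : 0 ≤ t := (le_max_right _ _).trans ht
  obtain ⟨ξ, hξ, hξ'⟩ := exists_hasDerivAt_eq_slope f h (a := t) (b := t + δ) (by linarith)
    (fun x hx => (hf x (ht0.trans hx.1)).continuousAt.continuousWithinAt)
    (fun x hx => hf x (ht0.trans hx.1.le))
  have h1 := hN t htN
  have h2 := hN (t + δ) (by linarith)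
  have h3 := hh.dist_le_mul t ξ
  have hξt : |t - ξ| ≤ δ := by
    rw [abs_sub_comm, abs_of_pos (by linarith [hξ.1])]; linarith [hξ.2]
  rw [Real.dist_eq] at h1 h2 h3 ⊢
  rw [Real.dist_eq] at h3
  have h3' : |h t - h ξ| ≤ ε / 2 :=
    h3.trans ((mul_le_mul_of_nonneg_left hξt hK).trans hKδ)
  have h4 : |h ξ| ≤ ε / 4 := by
    rw [hξ', abs_div, add_sub_cancel_left, abs_of_pos hδ0, div_le_iff₀ hδ0]
    rw [abs_lt] at h1 h2
    rw [abs_le]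
    constructor <;> nlinarith
  rw [sub_zero]
  calc |h t| = |(h t - h ξ) + h ξ| := by ring_nf
    _ ≤ |h t - h ξ| + |h ξ| := abs_add_le _ _
    _ < ε := by linarith

/-! ### The oscillator with truncated velocity. -/

/-- Truncation of a real number to the interval `[l, u]`. -/
def clip (l u x : ℝ) : ℝ := max l (min x u)

theorem lipschitzWith_clip (l u : ℝ) : LipschitzWith 1 (clip l u) :=
  (LipschitzWith.id.min_const u).const_max l

theorem clip_mem {l u : ℝ} (h : l ≤ u) (x : ℝ) : clip l u x ∈ Icc l u :=
  ⟨le_max_left _ _, max_le h (min_le_right _ _)⟩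

theorem clip_of_mem {l u x : ℝ} (h : x ∈ Icc l u) : clip l u x = x := by
  rw [clip, min_eq_left h.2, max_eq_right h.1]

theorem clip_of_le {l u x : ℝ} (h : l ≤ u) (hx : u ≤ x) : clip l u x = u := by
  rw [clip, min_eq_right hx, max_eq_right h]

theorem clip_neg {M : ℝ} (hM : 0 ≤ M) (x : ℝ) : clip (-M) M (-x) = -clip (-M) M x := by
  unfold clip
  simp only [min_def, max_def]
  split_ifs <;> linarith

theorem abs_clip_le {M : ℝ} (hM : 0 ≤ M) (x : ℝ) : |clip (-M) M x| ≤ M :=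
  abs_le.2 (clip_mem (by linarith) x)

theorem clip_nonpos {M x : ℝ} (hM : 0 ≤ M) (hx : x ≤ 0) : clip (-M) M x ≤ 0 :=
  max_le (by linarith) ((min_le_left _ _).trans hx)

theorem clip_nonneg {M x : ℝ} (hM : 0 ≤ M) (hx : 0 ≤ x) : 0 ≤ clip (-M) M x :=
  le_max_of_le_right (le_min hx hM)

theorem clip_neg_of_neg {M x : ℝ} (hM : 0 < M) (hx : x < 0) : clip (-M) M x < 0 :=
  max_lt (by linarith) ((min_le_left _ _).trans_lt hx)

theorem eq_zero_of_clip_eq_zero {M x : ℝ} (hM : 0 < M) (hx : clip (-M) M x = 0) : x = 0 := by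
  rcases lt_trichotomy x 0 with h | h | h
  · exact absurd hx (clip_neg_of_neg hM h).ne
  · exact h
  · have := clip_neg_of_neg hM (neg_lt_zero.2 h)
    rw [clip_neg hM.le, hx] at this
    simp at this

/-- The vector field of the oscillator with force `g`, linear friction `c` and truncated velocity. -/
def oscField (g : ℝ → ℝ) (c M : ℝ) (x : ℝ × ℝ) : ℝ × ℝ :=
  (clip (-M) M x.2, g x.1 + c * clip (-M) M x.2)

theorem exists_lipschitzWith_oscField {g : ℝ → ℝ} {K : ℝ≥0} (hg : LipschitzWith K g) (c M : ℝ) :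
    ∃ K', LipschitzWith K' (oscField g c M) := by
  have h1 : LipschitzWith (1 * 1) fun x : ℝ × ℝ => clip (-M) M x.2 :=
    (lipschitzWith_clip _ _).comp LipschitzWith.prod_snd
  exact ⟨_, h1.prodMk ((hg.comp LipschitzWith.prod_fst).add
    ((lipschitzWith_smul c).comp h1))⟩

theorem exists_bound_oscField {g : ℝ → ℝ} {C M : ℝ} (hg : ∀ x, |g x| ≤ C) (c : ℝ) (hM : 0 ≤ M) :
    ∃ L : ℝ≥0, ∀ x, ‖oscField g c M x‖ ≤ L := by
  have hC : 0 ≤ C := (abs_nonneg _).trans (hg 0)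
  refine ⟨⟨M + (C + |c| * M), by positivity⟩, fun x => ?_⟩
  have h1 := abs_clip_le hM x.2
  have h2 : |g x.1 + c * clip (-M) M x.2| ≤ C + |c| * M := by
    refine (abs_add_le _ _).trans (add_le_add (hg _) ?_)
    rw [abs_mul]
    gcongr
  have h3 : 0 ≤ |c| * M := by positivity
  rw [Prod.norm_def]
  exact max_le (h1.trans (by change M ≤ M + (C + |c| * M); linarith))
    (h2.trans (by change _ ≤ M + (C + |c| * M); linarith))

/-- Solutions of the first order system of the oscillator with force `g`, friction `c` and truncated velocity. -/
structure IsOsc (g : ℝ → ℝ) (c M : ℝ) (φ v : ℝ → ℝ) : Prop where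
  fst : ∀ t, HasDerivAt φ (clip (-M) M (v t)) t
  snd : ∀ t, HasDerivAt v (g (φ t) + c * clip (-M) M (v t)) t

theorem isOsc_iff {g : ℝ → ℝ} {c M : ℝ} {X : ℝ → ℝ × ℝ} :
    IsOsc g c M (fun t => (X t).1) (fun t => (X t).2) ↔
      ∀ t, HasDerivAt X (oscField g c M (X t)) t :=
  ⟨fun h t => (h.fst t).prodMk (h.snd t),
    fun h => ⟨fun t => (hasFDerivAt_fst (𝕜 := ℝ)).comp_hasDerivAt (f := X) t (h t),
      fun t => (hasFDerivAt_snd (𝕜 := ℝ)).comp_hasDerivAt (f := X) t (h t)⟩⟩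

/-- The second pair need only satisfy the equations along its own forward orbit. This allows a
comparison with solutions for another force that agrees with `g` there. -/
theorem IsOsc.eqOn {g : ℝ → ℝ} {K : ℝ≥0} (hg : LipschitzWith K g) {c M : ℝ} {φ v ψ w : ℝ → ℝ}
    (h : IsOsc g c M φ v)
    (h1 : ∀ t, 0 ≤ t → HasDerivAt ψ (clip (-M) M (w t)) t)
    (h2 : ∀ t, 0 ≤ t → HasDerivAt w (g (ψ t) + c * clip (-M) M (w t)) t)
    (h01 : φ 0 = ψ 0) (h02 : v 0 = w 0) {t : ℝ} (ht : 0 ≤ t) : φ t = ψ t ∧ v t = w t := by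
  obtain ⟨K', hK'⟩ := exists_lipschitzWith_oscField hg c M
  have e1 := fun s => (h.fst s).prodMk (h.snd s)
  have e2 := fun s hs => (h1 s hs).prodMk (h2 s hs)
  have := ODE_solution_unique (v := fun _ => oscField g c M) (fun _ => hK') (a := 0) (b := t)
    (fun s _ => (e1 s).continuousAt.continuousWithinAt)
    (fun s _ => (e1 s).hasDerivWithinAt)
    (fun s hs => (e2 s hs.1).continuousAt.continuousWithinAt)
    (fun s hs => (e2 s hs.1).hasDerivWithinAt) (by simp [h01, h02]) ⟨ht, le_rfl⟩
  exact Prod.mk.inj this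

/-- Reversing time flips the velocity and leaves the acceleration unchanged, so only the friction
changes sign. -/
theorem IsOsc.reverse {g : ℝ → ℝ} {c M : ℝ} (hM : 0 ≤ M) {φ v : ℝ → ℝ} (h : IsOsc g c M φ v) :
    IsOsc g (-c) M (fun t => φ (-t)) (fun t => -v (-t)) where
  fst t := ((h.fst (-t)).comp t (hasDerivAt_neg t)).congr_deriv (by simp [clip_neg hM])
  snd t := ((h.snd (-t)).comp t (hasDerivAt_neg t)).neg.congr_deriv (by simp [clip_neg hM])

theorem IsOsc.eq_const_of_equilibrium {g : ℝ → ℝ} {K : ℝ≥0} (hg : LipschitzWith K g) {c M : ℝ}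
    (hM : 0 ≤ M) {φ v : ℝ → ℝ} (h : IsOsc g c M φ v) {τ : ℝ} (h1 : g (φ τ) = 0) (h2 : v τ = 0)
    (t : ℝ) : φ t = φ τ := by
  obtain ⟨K', hK'⟩ := exists_lipschitzWith_oscField hg c M
  have hclip : clip (-M) M 0 = 0 := clip_of_mem ⟨by linarith, hM⟩
  have := ODE_solution_unique_univ (v := fun _ => oscField g c M) (s := fun _ => univ) (t₀ := τ)
    (f := fun t => (φ t, v t)) (g := fun _ => (φ τ, 0))
    (fun _ => hK'.lipschitzOnWith) (fun s => ⟨(h.fst s).prodMk (h.snd s), mem_univ _⟩)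
    (fun s => ⟨(hasDerivAt_const s (φ τ, (0 : ℝ))).congr_deriv (by
      simp [oscField, h1, hclip, ← Prod.mk_zero_zero]),
      mem_univ _⟩)
    (by simp [h2])
  exact (Prod.mk.inj (congrFun this t)).1

theorem IsOsc.lipschitz_fst {g : ℝ → ℝ} {c M : ℝ} (hM : 0 ≤ M) {φ v : ℝ → ℝ}
    (h : IsOsc g c M φ v) : LipschitzWith ⟨M, hM⟩ φ :=
  lipschitzWith_of_nnnorm_deriv_le (fun t => (h.fst t).differentiableAt) fun t => by
    rw [(h.fst t).deriv]
    exact abs_clip_le hM _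

theorem IsOsc.exists_lipschitz_snd {g : ℝ → ℝ} {c C M : ℝ} (hM : 0 ≤ M) (hg : ∀ x, |g x| ≤ C)
    {φ v : ℝ → ℝ} (h : IsOsc g c M φ v) : ∃ K, LipschitzWith K v := by
  have hC : 0 ≤ C := (abs_nonneg _).trans (hg 0)
  refine ⟨⟨C + |c| * M, by positivity⟩,
    lipschitzWith_of_nnnorm_deriv_le (fun t => (h.snd t).differentiableAt) fun t => ?_⟩
  rw [(h.snd t).deriv]
  have : |g (φ t) + c * clip (-M) M (v t)| ≤ C + |c| * M := by
    refine (abs_add_le _ _).trans (add_le_add (hg _) ?_)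
    rw [abs_mul]
    have := abs_clip_le hM (v t)
    gcongr
  exact this

/-- If the position converges, the velocity tends to zero. -/
theorem IsOsc.tendsto_snd_zero {g : ℝ → ℝ} {c C M : ℝ}
    (hM : 0 < M) (hC : ∀ x, |g x| ≤ C) {φ v : ℝ → ℝ} (h : IsOsc g c M φ v) {ℓ : ℝ}
    (hℓ : Tendsto φ atTop (𝓝 ℓ)) (hv : ∀ t, 0 ≤ t → |v t| ≤ M) : Tendsto v atTop (𝓝 0) := by
  obtain ⟨K', hK'⟩ := h.exists_lipschitz_snd hM.le hC
  exact tendsto_zero_of_lipschitz_deriv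
    (fun t ht => by simpa only [clip_of_mem (abs_le.1 (hv t ht))] using h.fst t) hK' hℓ

/-- If the velocity tends to zero, so does the force. -/
theorem IsOsc.tendsto_force_zero {g : ℝ → ℝ} {K : ℝ≥0} (hg : LipschitzWith K g) {c C M : ℝ}
    (hM : 0 < M) (hC : ∀ x, |g x| ≤ C) {φ v : ℝ → ℝ} (h : IsOsc g c M φ v)
    (hv : Tendsto v atTop (𝓝 0)) : Tendsto (fun t => g (φ t)) atTop (𝓝 0) := by
  obtain ⟨K', hK'⟩ := h.exists_lipschitz_snd hM.le hC
  have hclip : LipschitzWith _ fun t => clip (-M) M (v t) := (lipschitzWith_clip _ _).comp hK'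
  have h1 := tendsto_zero_of_lipschitz_deriv (fun t _ => h.snd t)
    ((hg.comp (h.lipschitz_fst hM.le)).add ((lipschitzWith_smul c).comp hclip)) hv
  have h2 : Tendsto (fun t => c * clip (-M) M (v t)) atTop (𝓝 (c * clip (-M) M 0)) :=
    ((((lipschitzWith_clip (-M) M).continuous.tendsto 0).comp hv).const_mul c)
  rw [clip_of_mem ⟨by linarith, hM.le⟩, mul_zero] at h2
  simpa using h1.sub h2

/-! ### Shooting towards the saddle. -/

/-- The system with negative damping has an orbit which starts at `m`, and whose position increases
and stays below the equilibrium `a` for all positive times. It is found by shooting on the initial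
velocity. -/
theorem exists_trapped_orbit {g : ℝ → ℝ} {a m d C M : ℝ} {K : ℝ≥0} (hg : LipschitzWith K g)
    (hC : ∀ x, |g x| ≤ C) (hd : 0 < d) (hm : m < a) (hneg : ∀ x < a, g x < 0)
    (hzero : ∀ x, a ≤ x → g x = 0) (hM0 : 0 < M) (hM : C < d * M) :
    ∃ ψ w : ℝ → ℝ, IsOsc g d M ψ w ∧ ψ 0 = m ∧ 0 < w 0 ∧
      ∀ t, 0 ≤ t → 0 ≤ w t ∧ w t ≤ M ∧ ψ t ≤ a := by
  have hgle : ∀ x, g x ≤ 0 := fun x =>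
    (lt_or_ge x a).elim (fun h => (hneg x h).le) (fun h => (hzero x h).le)
  obtain ⟨K', hK'⟩ := exists_lipschitzWith_oscField hg d M
  obtain ⟨B, hB⟩ := exists_bound_oscField hC d hM0.le
  choose X hX0 hX using exists_global_integralCurve hK' hB
  have hosc : ∀ x, IsOsc g d M (fun t => (X x t).1) (fun t => (X x t).2) :=
    fun x => isOsc_iff.2 (hX x)
  have hcont : ∀ t, 0 ≤ t → Continuous fun y => X (m, y) t := fun t ht =>
    (lipschitzWith_flow hK' hX0 hX ht).continuous.comp (by fun_prop)
  -- once negative, the velocity stays negative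
  have hstay : ∀ y t₀, (X (m, y) t₀).2 < 0 → ∀ t, t₀ ≤ t → (X (m, y) t).2 < 0 := by
    intro y t₀ h₀ t ht
    refine (le_initial_of_deriv_nonpos_below (c := 0) (fun s _ => (hosc (m, y)).snd s)
      (fun s _ hs => ?_) h₀ ht).trans_lt h₀
    have := clip_nonpos hM0.le hs.le
    nlinarith [hgle (X (m, y) s).1]
  -- `U₀` collects the velocities that are too small (the orbit turns back), `U₁` those that are too
  -- large (it overshoots `a`). Both are open by continuous dependence.
  set U₀ : Set ℝ := ⋃ t ∈ Ici (0 : ℝ), {y | (X (m, y) t).2 < 0} with hU₀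
  set U₁ : Set ℝ := ⋃ t ∈ Ici (0 : ℝ), {y | a < (X (m, y) t).1} with hU₁
  have hU₀o : IsOpen U₀ := isOpen_biUnion fun t ht =>
    isOpen_lt (continuous_snd.comp (hcont t ht)) continuous_const
  have hU₁o : IsOpen U₁ := isOpen_biUnion fun t ht =>
    isOpen_lt continuous_const (continuous_fst.comp (hcont t ht))
  have hdisj : ∀ y, y ∈ U₀ → y ∈ U₁ → False := by
    intro y h0 h1
    simp only [hU₀, hU₁, mem_iUnion, mem_ofPred_eq, mem_Ici, exists_prop] at h0 h1
    obtain ⟨t₀, ht₀, h0⟩ := h0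
    obtain ⟨t₁, ht₁, h1⟩ := h1
    have hc : Continuous fun t => (X (m, y) t).1 :=
      continuous_iff_continuousAt.2 fun t => ((hosc (m, y)).fst t).continuousAt
    set T := max t₀ t₁ + 1 with hT
    have hT₀ : t₀ < T := by linarith [le_max_left t₀ t₁]
    have hT₁ : t₁ < T := by linarith [le_max_right t₀ t₁]
    -- An orbit that both overshoots and turns back attains its maximum at an interior time, at rest
    -- beyond `a`. The force vanishes there, so by uniqueness the orbit is constant, although it
    -- starts at `m < a`.
    obtain ⟨τ, hτ, hmax⟩ := isCompact_Icc.exists_isMaxOn (nonempty_Icc.2 (ht₀.trans hT₀.le))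
      hc.continuousOn
    have hτa : a < (X (m, y) τ).1 := h1.trans_le (hmax ⟨ht₁, hT₁.le⟩)
    have hτ0 : 0 < τ := by
      refine lt_of_le_of_ne hτ.1 fun h => ?_
      rw [← h, hX0] at hτa
      exact absurd hτa hm.not_gt
    have hτT : τ < T := by
      refine lt_of_le_of_ne hτ.2 fun h => ?_
      obtain ⟨ξ, hξ, hξ'⟩ := exists_hasDerivAt_eq_slope _ _ hT₀ hc.continuousOn
        (fun x _ => (hosc (m, y)).fst x)
      have h2 := clip_neg_of_neg hM0 (hstay y t₀ h0 ξ hξ.1.le)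
      rw [hξ'] at h2
      have h3 := hmax (show t₀ ∈ Icc 0 T from ⟨ht₀, hT₀.le⟩)
      simp only [mem_ofPred_eq, h] at h3
      exact absurd h2 (not_lt.2 (div_nonneg (by linarith) (by linarith)))
    have hderiv := (hmax.isLocalMax (Icc_mem_nhds hτ0 hτT)).hasDerivAt_eq_zero
      ((hosc (m, y)).fst τ)
    have := (hosc (m, y)).eq_const_of_equilibrium hg hM0.le (hzero _ hτa.le)
      (eq_zero_of_clip_eq_zero hM0 hderiv) 0
    simp only [hX0] at this
    linarith
  have hzero_mem : ∀ y, y ≤ 0 → y ∈ U₀ := by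
    intro y hy
    by_contra hcon
    have hall : ∀ t, 0 ≤ t → 0 ≤ (X (m, y) t).2 := by
      intro t ht
      by_contra hlt
      exact hcon (mem_biUnion (mem_Ici.2 ht) (not_le.1 hlt))
    have hy0 : y = 0 := le_antisymm hy (by simpa [hX0] using hall 0 le_rfl)
    subst hy0
    -- Starting from rest at `m`, the acceleration is `g m < 0`, so the velocity cannot remain
    -- nonnegative.
    have hs := hasDerivWithinAt_iff_tendsto_slope' (s := Ioi (0 : ℝ)) (by simp) |>.1
      ((hosc (m, 0)).snd 0).hasDerivWithinAt
    have hge := ge_of_tendsto hs (eventually_mem_nhdsWithin.mono fun t ht => by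
      have ht' : (0 : ℝ) < t := ht
      rw [slope_def_field]
      simp only [hX0]
      exact div_nonneg (by linarith [hall t ht'.le]) (by linarith))
    simp only [hX0, clip_of_mem (show (0 : ℝ) ∈ Icc (-M) M from ⟨by linarith, hM0.le⟩)] at hge
    linarith [hneg m hm]
  have hlarge : ∃ y, 0 ≤ y ∧ y ∈ U₁ := by
    set T := (a - m) / M + 1 with hT
    have hT0 : 0 < T := by have : 0 < (a - m) / M := div_pos (by linarith) hM0
                           linarith
    have hC0 : 0 ≤ C := (abs_nonneg _).trans (hC 0)
    -- The deceleration never exceeds `C + d * M`, so the velocity stays at least `M` up to time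
    -- `T`, long enough to pass `a`.
    set y := M + (C + d * M) * T with hy
    have hvel : ∀ t ∈ Icc 0 T, M ≤ (X (m, y) t).2 := by
      intro t ht
      rcases ht.1.eq_or_lt with h | h
      · rw [← h, hX0, hy]
        have : 0 ≤ (C + d * M) * T := by positivity
        simpa using this
      · obtain ⟨ξ, hξ, hξ'⟩ := exists_hasDerivAt_eq_slope _ _ h
          (fun x _ => ((hosc (m, y)).snd x).continuousAt.continuousWithinAt)
          (fun x _ => (hosc (m, y)).snd x)
        simp only [hX0, sub_zero] at hξ'
        rw [eq_div_iff h.ne'] at hξ'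
        have h1 := (abs_le.1 (hC (X (m, y) ξ).1)).1
        have h2 := (abs_le.1 (abs_clip_le hM0.le (X (m, y) ξ).2)).1
        have h3 : -(C + d * M) ≤ g (X (m, y) ξ).1 + d * clip (-M) M (X (m, y) ξ).2 := by
          nlinarith
        have h4 : -(C + d * M) * t ≤
            (g (X (m, y) ξ).1 + d * clip (-M) M (X (m, y) ξ).2) * t := by gcongr
        have h5 : (C + d * M) * t ≤ (C + d * M) * T := by gcongr; exact ht.2
        linarith
    refine ⟨y, by positivity, mem_biUnion (mem_Ici.2 hT0.le) ?_⟩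
    obtain ⟨ξ, hξ, hξ'⟩ := exists_hasDerivAt_eq_slope _ _ hT0
      (fun x _ => ((hosc (m, y)).fst x).continuousAt.continuousWithinAt)
      (fun x _ => (hosc (m, y)).fst x)
    rw [clip_of_le (by linarith) (hvel ξ (Ioo_subset_Icc_self hξ)), eq_div_iff (by linarith)] at hξ'
    simp only [hX0, sub_zero] at hξ'
    have : M * T = a - m + M := by rw [hT]; field_simp
    change a < (X (m, y) T).1
    linarith
  obtain ⟨y, hy0, hyU₀, hyU₁⟩ : ∃ y, 0 ≤ y ∧ y ∉ U₀ ∧ y ∉ U₁ := by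
    by_contra hcon
    push Not at hcon
    obtain ⟨y₁, hy₁, hy₁'⟩ := hlarge
    obtain ⟨z, -, hz0, hz1⟩ := isPreconnected_Ici (a := (0 : ℝ)) U₀ U₁ hU₀o hU₁o
      (fun y hy => by
        by_cases h : y ∈ U₀
        · exact Or.inl h
        · exact Or.inr (hcon y hy h))
      ⟨0, mem_Ici.2 le_rfl, hzero_mem 0 le_rfl⟩ ⟨y₁, hy₁, hy₁'⟩
    exact hdisj z hz0 hz1
  have hpos : ∀ t, 0 ≤ t → 0 ≤ (X (m, y) t).2 := by
    intro t ht
    by_contra hlt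
    exact hyU₀ (mem_biUnion (mem_Ici.2 ht) (not_le.1 hlt))
  have hle : ∀ t, 0 ≤ t → (X (m, y) t).1 ≤ a := by
    intro t ht
    by_contra hlt
    exact hyU₁ (mem_biUnion (mem_Ici.2 ht) (not_le.1 hlt))
  refine ⟨_, _, hosc (m, y), by simp [hX0], ?_, fun t ht => ⟨hpos t ht, ?_, hle t ht⟩⟩
  · simp only [hX0]
    by_contra hlt
    exact hyU₀ (hzero_mem y (not_lt.1 hlt))
  · by_contra hlt
    push Not at hlt
    -- Above `M` the anti-damping `d * M` beats the force bound `C`, so the velocity never drops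
    -- back and `a` would be passed in finite time.
    have hstayM : ∀ s, t ≤ s → M ≤ (X (m, y) s).2 := by
      intro s hs
      have := le_initial_of_deriv_nonpos_below (c := -M)
        (fun s _ => ((hosc (m, y)).snd s).neg)
        (fun s _ hs => by
          rw [Pi.neg_apply] at hs
          rw [clip_of_le (by linarith) (by linarith)]
          linarith [(abs_le.1 (hC (X (m, y) s).1)).1]) (by simpa using hlt) hs
      simp only [Pi.neg_apply] at this
      linarith
    set T := (a - (X (m, y) t).1) / M + 1 with hT
    have hT0 : 0 < T := by
      have : 0 ≤ (a - (X (m, y) t).1) / M := div_nonneg (by linarith [hle t ht]) hM0.le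
      linarith
    obtain ⟨ξ, hξ, hξ'⟩ := exists_hasDerivAt_eq_slope _ _ (show t < t + T by linarith)
      (fun x _ => ((hosc (m, y)).fst x).continuousAt.continuousWithinAt)
      (fun x _ => (hosc (m, y)).fst x)
    rw [clip_of_le (by linarith) (hstayM ξ hξ.1.le), eq_div_iff (by linarith)] at hξ'
    have h1 : M * T = a - (X (m, y) t).1 + M := by rw [hT]; field_simp
    have h2 := hle (t + T) (by linarith)
    rw [add_sub_cancel_left] at hξ'
    linarith

/-! ### Energy balance and the two limits. -/

theorem exists_tendsto_of_monotoneOn_Ici {f : ℝ → ℝ} {c : ℝ} (hf : MonotoneOn f (Ici 0))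
    (hc : ∀ t, 0 ≤ t → f t ≤ c) : ∃ ℓ, Tendsto f atTop (𝓝 ℓ) := by
  have hmono : Monotone fun t => f (max 0 t) := fun s t hst =>
    hf (mem_Ici.2 (le_max_left _ _)) (mem_Ici.2 (le_max_left _ _)) (max_le_max le_rfl hst)
  have hbdd : BddAbove (range fun t => f (max 0 t)) :=
    ⟨c, by rintro _ ⟨t, rfl⟩; exact hc _ (le_max_left _ _)⟩
  refine ⟨_, (tendsto_atTop_ciSup hmono hbdd).congr' ?_⟩
  filter_upwards [eventually_ge_atTop 0] with t ht
  rw [max_eq_right ht]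

theorem monotoneOn_Ici_of_hasDerivAt_nonneg {f f' : ℝ → ℝ} {t₀ : ℝ}
    (hf : ∀ t, t₀ ≤ t → HasDerivAt f (f' t) t) (hf' : ∀ t, t₀ ≤ t → 0 ≤ f' t) :
    MonotoneOn f (Ici t₀) := by
  refine monotoneOn_of_deriv_nonneg (convex_Ici t₀)
    (fun t ht => (hf t ht).continuousAt.continuousWithinAt) (fun t ht => ?_) (fun t ht => ?_)
  all_goals rw [interior_Ici] at ht
  · exact (hf t ht.le).differentiableAt.differentiableWithinAt
  · rw [(hf t ht.le).deriv]
    exact hf' t ht.le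

/-- The energy balance of the damped oscillator. -/
theorem IsOsc.hasDerivAt_energy {g G : ℝ → ℝ} {c M : ℝ} {φ v : ℝ → ℝ} (h : IsOsc g c M φ v)
    {t : ℝ} (hG : HasDerivAt G (g (φ t)) (φ t)) (hv : |v t| ≤ M) :
    HasDerivAt (fun s => v s ^ 2 / 2 - G (φ s)) (c * v t ^ 2) t := by
  have h1 := h.fst t
  have h2 := h.snd t
  rw [clip_of_mem (abs_le.1 hv)] at h1 h2
  refine (((h2.pow 2).div_const 2).sub (hG.comp t h1)).congr_deriv ?_
  push_cast
  ring

/-- A trapped orbit of the oscillator with negative damping converges to the saddle. -/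
theorem IsOsc.tendsto_saddle {g G : ℝ → ℝ} {a m d C M : ℝ} {K : ℝ≥0} (hg : LipschitzWith K g)
    (hC : ∀ x, |g x| ≤ C) (hd : 0 < d) (hneg : ∀ x < a, g x < 0)
    (hG : ∀ x ∈ Icc m a, HasDerivAt G (g x) x) (hM0 : 0 < M) {ψ w : ℝ → ℝ}
    (h : IsOsc g d M ψ w) (hψ0 : ψ 0 = m) (hw0 : 0 < w 0)
    (hall : ∀ t, 0 ≤ t → 0 ≤ w t ∧ w t ≤ M ∧ ψ t ≤ a) :
    (∀ t, 0 ≤ t → m ≤ ψ t) ∧ Tendsto ψ atTop (𝓝 a) ∧ Tendsto w atTop (𝓝 0) ∧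
      w 0 ^ 2 / 2 - G m < -G a := by
  have habs : ∀ t, 0 ≤ t → |w t| ≤ M := fun t ht => by
    rw [abs_of_nonneg (hall t ht).1]
    exact (hall t ht).2.1
  have hmono : MonotoneOn ψ (Ici 0) := monotoneOn_Ici_of_hasDerivAt_nonneg (fun t _ => h.fst t)
    (fun t ht => clip_nonneg hM0.le (hall t ht).1)
  have hm : ∀ t, 0 ≤ t → m ≤ ψ t := fun t ht => by
    rw [← hψ0]
    exact hmono (mem_Ici.2 le_rfl) ht ht
  obtain ⟨ℓ, hℓ⟩ := exists_tendsto_of_monotoneOn_Ici hmono (fun t ht => (hall t ht).2.2)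
  have hw := h.tendsto_snd_zero hM0 hC hℓ habs
  have hforce := h.tendsto_force_zero hg hM0 hC hw
  have hgℓ : g ℓ = 0 := tendsto_nhds_unique ((hg.continuous.tendsto ℓ).comp hℓ) hforce
  have hℓa : ℓ ≤ a := le_of_tendsto hℓ (by
    filter_upwards [eventually_ge_atTop 0] with t ht using (hall t ht).2.2)
  obtain rfl : ℓ = a := hℓa.eq_of_not_lt fun hlt => (hneg ℓ hlt).ne hgℓ
  refine ⟨hm, hℓ, hw, ?_⟩
  have hma : m ≤ ℓ := (hm 0 le_rfl).trans (hall 0 le_rfl).2.2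
  have hE : ∀ t, 0 ≤ t → HasDerivAt (fun s => w s ^ 2 / 2 - G (ψ s)) (d * w t ^ 2) t :=
    fun t ht => h.hasDerivAt_energy (hG _ ⟨hm t ht, (hall t ht).2.2⟩) (habs t ht)
  have hEmono : MonotoneOn (fun s => w s ^ 2 / 2 - G (ψ s)) (Ici 0) :=
    monotoneOn_Ici_of_hasDerivAt_nonneg hE (fun t _ => by positivity)
  have hElim : Tendsto (fun s => w s ^ 2 / 2 - G (ψ s)) atTop (𝓝 (0 ^ 2 / 2 - G ℓ)) :=
    ((hw.pow 2).div_const 2).sub (((hG ℓ ⟨hma, le_rfl⟩).continuousAt.tendsto).comp hℓ)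
  have hEle : ∀ t, 0 ≤ t → w t ^ 2 / 2 - G (ψ t) ≤ -G ℓ := fun t ht => by
    have := ge_of_tendsto hElim (by
      filter_upwards [eventually_ge_atTop t] with s hs using hEmono ht (ht.trans hs) hs)
    simpa using this
  rw [← hψ0]
  by_contra hcon
  -- Equality with the limiting energy would make the energy constant, against its derivative `d * w
  -- 0 ^ 2 > 0` at time `0`.
  have hconst : ∀ t ∈ Ici (0 : ℝ), w t ^ 2 / 2 - G (ψ t) = w 0 ^ 2 / 2 - G (ψ 0) := fun t ht =>
    le_antisymm ((hEle t ht).trans (not_lt.1 hcon)) (hEmono (mem_Ici.2 le_rfl) ht ht)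
  have h1 := (hE 0 le_rfl).hasDerivWithinAt (s := Ici 0)
  have h2 := (hasDerivWithinAt_const (0 : ℝ) (Ici 0) (w 0 ^ 2 / 2 - G (ψ 0))).congr hconst rfl
  have h3 := (uniqueDiffWithinAt_Ici (0 : ℝ)).eq_deriv _ h1 h2
  have : 0 < d * w 0 ^ 2 := by positivity
  linarith

/-- An orbit of the damped oscillator with energy below the level of the saddle `a` remains in the
potential well and converges to the sink `b`. -/
theorem IsOsc.tendsto_sink {g G : ℝ → ℝ} {a b L d C M : ℝ} {K : ℝ≥0} (hg : LipschitzWith K g)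
    (hC : ∀ x, |g x| ≤ C) (hd : 0 < d) (hM0 : 0 < M) (hM : C < d * M)
    (hG : ∀ x, HasDerivAt G (g x) x) (hL : G L < G a)
    (hzero : ∀ x ∈ Ico L a, g x = 0 → x = b) {φ v : ℝ → ℝ} (h : IsOsc g (-d) M φ v)
    (h0 : φ 0 ∈ Ioo L a) (hv0 : |v 0| ≤ M) (hE0 : v 0 ^ 2 / 2 - G (φ 0) < -G a) :
    (∀ t, 0 ≤ t → φ t ∈ Ioo L a ∧ |v t| ≤ M) ∧ Tendsto φ atTop (𝓝 b) ∧
      Tendsto v atTop (𝓝 0) := by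
  have hclipM : clip (-M) M M = M := clip_of_mem ⟨by linarith, le_rfl⟩
  have hvcont : Continuous v := continuous_iff_continuousAt.2 fun t => (h.snd t).continuousAt
  have hφcont : Continuous φ := continuous_iff_continuousAt.2 fun t => (h.fst t).continuousAt
  have hGcont : Continuous G := continuous_iff_continuousAt.2 fun t => (hG t).continuousAt
  -- At `v = ±M` friction dominates the force and points inward.
  have hv : ∀ t, 0 ≤ t → |v t| ≤ M := by
    intro t ht
    rw [abs_le] at hv0 ⊢
    constructor
    · have := image_le_of_deriv_right_lt_deriv_boundary (f := fun t => -v t) (a := 0) (b := t)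
        (B := fun _ => M) (B' := fun _ => 0) hvcont.neg.continuousOn
        (fun x _ => (h.snd x).neg.hasDerivWithinAt) (by linarith)
        (fun x => hasDerivAt_const x M) (fun x _ hx => by
          rw [show v x = -M by linarith, clip_neg hM0.le, hclipM]
          linarith [(abs_le.1 (hC (φ x))).1]) ⟨ht, le_rfl⟩
      linarith
    · exact image_le_of_deriv_right_lt_deriv_boundary (f := v) (a := 0) (b := t)
        (B := fun _ => M) (B' := fun _ => 0) hvcont.continuousOn
        (fun x _ => (h.snd x).hasDerivWithinAt) hv0.2
        (fun x => hasDerivAt_const x M) (fun x _ hx => by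
          rw [hx, hclipM]
          linarith [(abs_le.1 (hC (φ x))).2]) ⟨ht, le_rfl⟩
  set E : ℝ → ℝ := fun s => v s ^ 2 / 2 - G (φ s) with hEdef
  have hE : ∀ t, 0 ≤ t → HasDerivAt E (-d * v t ^ 2) t :=
    fun t ht => h.hasDerivAt_energy (hG _) (hv t ht)
  have hEmono : MonotoneOn (-E) (Ici 0) :=
    monotoneOn_Ici_of_hasDerivAt_nonneg (fun t ht => (hE t ht).neg) (fun t _ => by
      rw [neg_mul, neg_neg]
      positivity)
  have hGlow : ∀ t, 0 ≤ t → -E 0 ≤ G (φ t) := fun t ht => by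
    have h1 : -E 0 ≤ -E t := hEmono (mem_Ici.2 le_rfl) ht ht
    have h2 : 0 ≤ v t ^ 2 / 2 := by positivity
    have h3 : E t = v t ^ 2 / 2 - G (φ t) := rfl
    linarith
  have hGa : G a < -E 0 := by
    have : E 0 < -G a := hE0
    linarith
  -- Dissipation keeps `G (φ t)` above a level exceeding both `G L` and `G a`, so neither wall can
  -- be reached.
  have htrap : ∀ t, 0 ≤ t → φ t ∈ Ioo L a := by
    intro t ht
    constructor
    · by_contra hlt
      obtain ⟨s, hs, hs'⟩ := intermediate_value_Icc' ht hφcont.continuousOn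
        ⟨not_lt.1 hlt, h0.1.le⟩
      have := hGlow s hs.1
      rw [hs'] at this
      linarith
    · by_contra hlt
      obtain ⟨s, hs, hs'⟩ := intermediate_value_Icc ht hφcont.continuousOn
        ⟨h0.2.le, not_lt.1 hlt⟩
      have := hGlow s hs.1
      rw [hs'] at this
      linarith
  obtain ⟨N, hN⟩ := isCompact_Icc.exists_bound_of_continuousOn (s := Icc L a) hGcont.continuousOn
  obtain ⟨ℓ, hℓ⟩ := exists_tendsto_of_monotoneOn_Ici hEmono (c := N) fun t ht => by
    have h1 := (abs_le.1 (hN _ (Ioo_subset_Icc_self (htrap t ht)))).2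
    have h2 : 0 ≤ v t ^ 2 / 2 := by positivity
    change -(v t ^ 2 / 2 - G (φ t)) ≤ N
    linarith
  obtain ⟨K', hK'⟩ := h.exists_lipschitz_snd hM0.le hC
  have hclipL : LipschitzWith _ fun t => clip (-M) M (v t) := (lipschitzWith_clip _ _).comp hK'
  have hsqL : LipschitzWith ((2 * d * M).toNNReal * (1 * K'))
      fun t => d * clip (-M) M (v t) ^ 2 := by
    refine LipschitzWith.of_dist_le_mul fun s t => ?_
    have h1 := hclipL.dist_le_mul s t
    rw [NNReal.coe_mul, Real.coe_toNNReal _ (by positivity)]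
    rw [Real.dist_eq] at h1 ⊢
    have h2 : d * clip (-M) M (v s) ^ 2 - d * clip (-M) M (v t) ^ 2 =
      d * (clip (-M) M (v s) + clip (-M) M (v t)) *
        (clip (-M) M (v s) - clip (-M) M (v t)) := by ring
    have h3 : |clip (-M) M (v s) + clip (-M) M (v t)| ≤ 2 * M :=
      (abs_add_le _ _).trans (by linarith [abs_clip_le hM0.le (v s), abs_clip_le hM0.le (v t)])
    rw [h2, abs_mul, abs_mul, abs_of_pos hd]
    calc d * |clip (-M) M (v s) + clip (-M) M (v t)| * |clip (-M) M (v s) - clip (-M) M (v t)|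
        ≤ d * (2 * M) * (↑(1 * K') * dist s t) := by gcongr
      _ = _ := by ring
  have hsq : Tendsto (fun t => d * clip (-M) M (v t) ^ 2) atTop (𝓝 0) :=
    tendsto_zero_of_lipschitz_deriv (f := -E) (fun t ht => (hE t ht).neg.congr_deriv (by
      rw [clip_of_mem (abs_le.1 (hv t ht))]; ring)) hsqL hℓ
  have hvlim : Tendsto v atTop (𝓝 0) := by
    have h1 : Tendsto (fun t => √(d * clip (-M) M (v t) ^ 2 / d)) atTop (𝓝 √(0 / d)) :=
      (hsq.div_const d).sqrt
    rw [zero_div, Real.sqrt_zero] at h1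
    rw [tendsto_zero_iff_abs_tendsto_zero]
    refine h1.congr' ?_
    filter_upwards [eventually_ge_atTop 0] with t ht
    rw [mul_div_cancel_left₀ _ hd.ne', Real.sqrt_sq_eq_abs, clip_of_mem (abs_le.1 (hv t ht))]
    rfl
  refine ⟨fun t ht => ⟨htrap t ht, hv t ht⟩, ?_, hvlim⟩
  have hforce := h.tendsto_force_zero hg hM0 hC hvlim
  have hcomp : IsCompact (Icc L a ∩ G ⁻¹' Ici (-E 0)) :=
    isCompact_Icc.inter_right (isClosed_Ici.preimage hGcont)
  -- A cluster point of `φ` is a zero of the force, and the energy bound excludes `a`; only `b` is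
  -- left.
  refine hcomp.tendsto_nhds_of_unique_mapClusterPt ?_ ?_
  · filter_upwards [eventually_ge_atTop 0] with t ht
      using ⟨Ioo_subset_Icc_self (htrap t ht), hGlow t ht⟩
  · intro y hy hcl
    have hya : y ≠ a := by
      rintro rfl
      exact absurd hy.2 (not_le.2 hGa)
    refine hzero y ⟨hy.1.1, lt_of_le_of_ne hy.1.2 hya⟩ ?_
    exact eq_of_nhds_neBot
      (ClusterPt.mono (hcl.continuousAt_comp hg.continuous.continuousAt) hforce)

/-! ### Assembling the heteroclinic orbit. -/

/-- Supplies the left wall of the well: moving `1 + |I|` further left, where `g ≥ 1`, outweighs the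
integral `I` over the rest. -/
theorem exists_integral_pos_of_one_le {g : ℝ → ℝ} (hg : Continuous g) (a b x₀ : ℝ)
    (hinf : ∀ x ≤ x₀, 1 ≤ g x) : ∃ L < b, 0 < ∫ x in L..a, g x := by
  set x₁ := min x₀ (b - 1) with hx₁
  set I := ∫ x in x₁..a, g x with hI
  have hint : ∀ p q, IntervalIntegrable g MeasureTheory.volume p q := fun p q =>
    hg.intervalIntegrable p q
  refine ⟨x₁ - 1 - |I|, ?_, ?_⟩
  · linarith [min_le_right x₀ (b - 1), abs_nonneg I]
  · rw [← intervalIntegral.integral_add_adjacent_intervals (hint _ x₁) (hint _ _)]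
    have h1 : ∫ _ in (x₁ - 1 - |I|)..x₁, (1 : ℝ) ≤ ∫ x in (x₁ - 1 - |I|)..x₁, g x :=
      intervalIntegral.integral_mono_on (by linarith [abs_nonneg I])
        (continuous_const.intervalIntegrable _ _) (hint _ _)
        (fun x hx => hinf x (hx.2.trans (min_le_left _ _)))
    rw [intervalIntegral.integral_const, smul_eq_mul, mul_one] at h1
    linarith [neg_abs_le I]

/-- Existence of a heteroclinic orbit from the saddle `a` to the sink `b` of the damped oscillator
with force `g` and friction coefficient `d`. -/
theorem exists_heteroclinic {g : ℝ → ℝ} (hg : ContDiff ℝ 1 g) {a b d x₀ : ℝ} (hd : 0 < d)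
    (hba : b < a) (ha : g a = 0) (hneg : ∀ x ∈ Ioo b a, g x < 0) (hpos : ∀ x < b, 0 < g x)
    (hinf : ∀ x ≤ x₀, 1 ≤ g x) :
    ∃ φ v : ℝ → ℝ, (∀ t, HasDerivAt φ (v t) t) ∧ (∀ t, HasDerivAt v (g (φ t) - d * v t) t) ∧
      Tendsto φ atBot (𝓝 a) ∧ Tendsto φ atTop (𝓝 b) ∧
      Tendsto v atBot (𝓝 0) ∧ Tendsto v atTop (𝓝 0) := by
  obtain ⟨L, hLb, hL⟩ := exists_integral_pos_of_one_le hg.continuous a b x₀ hinf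
  have hLa : L < a := hLb.trans hba
  obtain ⟨m, hbm, hma⟩ := exists_between hba
  have hLm : L < m := hLb.trans hbm
  obtain ⟨K, hK⟩ := hg.contDiffOn.exists_lipschitzOnWith one_ne_zero (convex_Icc L a) isCompact_Icc
  obtain ⟨C, hC⟩ := isCompact_Icc.exists_bound_of_continuousOn (s := Icc L a)
    hg.continuous.continuousOn
  have hC0 : 0 ≤ C := (norm_nonneg _).trans (hC a ⟨hLa.le, le_rfl⟩)
  have hsub : Icc m a ⊆ Icc L a := Icc_subset_Icc_left hLm.le
  -- `gc` is used for the forward orbit in the whole well. `gm` also freezes the force left of `m`,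
  -- so that it is negative everywhere below `a`, as shooting requires.
  set gc : ℝ → ℝ := fun x => g (clip L a x) with hgc
  set gm : ℝ → ℝ := fun x => g (clip m a x) with hgm
  have hgcL : LipschitzWith (K * 1) gc :=
    lipschitzOnWith_univ.1 (hK.comp (lipschitzWith_clip L a).lipschitzOnWith
      fun x _ => clip_mem hLa.le x)
  have hgmL : LipschitzWith (K * 1) gm :=
    lipschitzOnWith_univ.1 (hK.comp (lipschitzWith_clip m a).lipschitzOnWith
      fun x _ => hsub (clip_mem hma.le x))
  have hgcC : ∀ x, |gc x| ≤ C := fun x => hC _ (clip_mem hLa.le x)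
  have hgmC : ∀ x, |gm x| ≤ C := fun x => hC _ (hsub (clip_mem hma.le x))
  have hgc_eq : ∀ x ∈ Icc L a, gc x = g x := fun x hx => by rw [hgc]; simp only [clip_of_mem hx]
  have hgm_eq : ∀ x ∈ Icc m a, gm x = gc x := fun x hx => by
    rw [hgc_eq x (hsub hx), hgm]; simp only [clip_of_mem hx]
  set M := C / d + 1 with hMdef
  have hM0 : 0 < M := by positivity
  have hM : C < d * M := by
    rw [hMdef, mul_add, mul_div_cancel₀ _ hd.ne', mul_one]
    linarith
  have hgmneg : ∀ x < a, gm x < 0 := fun x hx => hneg _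
    ⟨hbm.trans_le (clip_mem hma.le x).1, max_lt hma ((min_le_left _ _).trans_lt hx)⟩
  have hgmzero : ∀ x, a ≤ x → gm x = 0 := fun x hx => by
    rw [hgm]; simp only [clip_of_le hma.le hx, ha]
  obtain ⟨ψ, w, hψ, hψ0, hw0, hall⟩ :=
    exists_trapped_orbit hgmL hgmC hd hma hgmneg hgmzero hM0 hM
  set G : ℝ → ℝ := fun x => ∫ y in L..x, gc y with hGdef
  have hG : ∀ x, HasDerivAt G (gc x) x := fun x =>
    intervalIntegral.integral_hasDerivAt_right (hgcL.continuous.intervalIntegrable _ _)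
      (hgcL.continuous.stronglyMeasurableAtFilter _ _) hgcL.continuous.continuousAt
  have hGL : G L < G a := by
    have h1 : G a = ∫ x in L..a, g x := intervalIntegral.integral_congr fun x hx =>
      hgc_eq x (by rwa [uIcc_of_le hLa.le] at hx)
    rw [h1, hGdef]
    simpa using hL
  obtain ⟨hψm, hψlim, hwlim, hE⟩ := hψ.tendsto_saddle hgmL hgmC hd hgmneg
    (fun x hx => (hgm_eq x hx) ▸ hG x) hM0 hψ0 hw0 hall
  obtain ⟨K', hK'⟩ := exists_lipschitzWith_oscField hgcL (-d) M
  obtain ⟨B, hB⟩ := exists_bound_oscField hgcC (-d) hM0.le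
  -- The shooting velocity is negated: backward in time this curve retraces `ψ` up to the saddle.
  obtain ⟨X, hX0, hX⟩ := exists_global_integralCurve hK' hB (m, -w 0)
  have hosc := isOsc_iff.2 hX
  have hback : ∀ t, 0 ≤ t → (X (-t)).1 = ψ t ∧ -(X (-t)).2 = w t := fun t ht => by
    have h1 := hosc.reverse hM0.le
    rw [neg_neg] at h1
    exact h1.eqOn hgcL (fun t _ => hψ.fst t) (fun t ht => by
      rw [← hgm_eq (ψ t) ⟨hψm t ht, (hall t ht).2.2⟩]
      exact hψ.snd t) (by simp [hX0, hψ0]) (by simp [hX0]) ht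
  obtain ⟨hfwd, hφlim, hvlim⟩ := hosc.tendsto_sink hgcL hgcC hd hM0 hM hG hGL (b := b)
    (fun x hx hx0 => by
      rw [hgc_eq x (Ico_subset_Icc_self hx)] at hx0
      rcases lt_trichotomy x b with h | h | h
      · exact absurd hx0 (hpos x h).ne'
      · exact h
      · exact absurd hx0 (hneg x ⟨h, hx.2⟩).ne)
    (by simpa [hX0] using ⟨hLm, hma⟩)
    (by simpa [hX0, abs_of_pos hw0] using (hall 0 le_rfl).2.1) (by simpa [hX0] using hE)
  have hbox : ∀ t, (X t).1 ∈ Icc L a ∧ (X t).2 ∈ Icc (-M) M := by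
    intro t
    rcases le_total 0 t with ht | ht
    · exact ⟨Ioo_subset_Icc_self (hfwd t ht).1, abs_le.1 (hfwd t ht).2⟩
    · obtain ⟨h1, h2⟩ := hback (-t) (by linarith)
      rw [neg_neg] at h1 h2
      obtain ⟨h3, h4, h5⟩ := hall (-t) (by linarith)
      have h6 := hψm (-t) (by linarith)
      rw [h1]
      exact ⟨⟨hLm.le.trans h6, h5⟩, by linarith, by linarith⟩
  refine ⟨_, _, fun t => ?_, fun t => ?_, ?_, hφlim, ?_, hvlim⟩
  · simpa only [clip_of_mem (hbox t).2] using hosc.fst t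
  · have := hosc.snd t
    rw [clip_of_mem (hbox t).2, hgc_eq _ (hbox t).1, neg_mul, ← sub_eq_add_neg] at this
    exact this
  · refine (hψlim.comp tendsto_neg_atBot_atTop).congr' ?_
    filter_upwards [eventually_le_atBot 0] with t ht
    simpa using (hback (-t) (by linarith)).1.symm
  · rw [← neg_zero]
    refine (hwlim.neg.comp tendsto_neg_atBot_atTop).congr' ?_
    filter_upwards [eventually_le_atBot 0] with t ht
    simp [← (hback (-t) (by linarith)).2]

/-! ### From the oscillator to solutions of the QHD system. -/

theorem dx_travelingWave {s ε : ℝ} {F F' : ℝ → ℝ} (hF : ∀ y, HasDerivAt F (F' y) y) :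
    dx (travelingWave s ε F) = travelingWave s ε (fun y => F' y / ε) := by
  funext t x
  have h1 : HasDerivAt (fun y => (y - s * t) / ε) (1 / ε) x :=
    ((hasDerivAt_id x).sub_const _).div_const _
  have := ((hF ((x - s * t) / ε)).comp x h1).deriv
  simp only [Function.comp_def] at this
  simp only [dx, travelingWave, this]
  ring

theorem dt_travelingWave {s ε : ℝ} {F F' : ℝ → ℝ} (hF : ∀ y, HasDerivAt F (F' y) y) :
    dt (travelingWave s ε F) = travelingWave s ε (fun y => -s * F' y / ε) := by
  funext t x
  have h1 : HasDerivAt (fun τ => (x - s * τ) / ε) (-(s * 1) / ε) t :=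
    (((hasDerivAt_id t).const_mul s).const_sub _).div_const _
  have := ((hF ((x - s * t) / ε)).comp t h1).deriv
  simp only [Function.comp_def] at this
  simp only [dt, travelingWave, this]
  ring

theorem contDiff_succ_of_hasDerivAt {f f' : ℝ → ℝ} {n : ℕ} (hf : ∀ t, HasDerivAt f (f' t) t)
    (hf' : ContDiff ℝ n f') : ContDiff ℝ (n + 1 : ℕ) f := by
  have : deriv f = f' := funext fun t => (hf t).deriv
  rw [Nat.cast_add, Nat.cast_one, contDiff_succ_iff_deriv, this]
  exact ⟨fun t => (hf t).differentiableAt, by simp, hf'⟩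

/-- The force `g` in the damped oscillator equation satisfied by the logarithm of the density
profile. -/
noncomputable def profileForce (γ k A B φ : ℝ) : ℝ :=
  2 / k ^ 2 * (Real.exp (-φ) * (Real.exp (γ * φ) + A ^ 2 * Real.exp (-φ) - B))

theorem hasDerivAt_profileForce (γ k A B φ : ℝ) :
    HasDerivAt (profileForce γ k A B)
      (2 / k ^ 2 * (-Real.exp (-φ) * (Real.exp (γ * φ) + A ^ 2 * Real.exp (-φ) - B) +
        Real.exp (-φ) * (γ * Real.exp (γ * φ) - A ^ 2 * Real.exp (-φ)))) φ := by
  have h1 : HasDerivAt (fun x => Real.exp (-x)) (-Real.exp (-φ)) φ := by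
    simpa using (hasDerivAt_neg φ).exp
  have h2 : HasDerivAt (fun x => Real.exp (γ * x)) (γ * Real.exp (γ * φ)) φ := by
    simpa [mul_comm] using ((hasDerivAt_id φ).const_mul γ).exp
  exact ((h1.mul ((h2.add (h1.const_mul (A ^ 2))).sub_const B)).const_mul (2 / k ^ 2)).congr_deriv
    (by simp only [Pi.add_apply]; ring)

theorem contDiff_profileForce (γ k A B : ℝ) {n : WithTop ℕ∞} :
    ContDiff ℝ n (profileForce γ k A B) := by
  unfold profileForce
  fun_prop

/-- In logarithmic form the Bohm potential is `(θ' ^ 2 / 4 + θ'' / 2) / ε ^ 2`, and the momentum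
equation is the derivative of the oscillator equation multiplied by `exp θ`. All powers of `ε`
cancel. -/
theorem isSolution_of_profile {γ μ k s A B : ℝ} (hk : k ≠ 0) {θ θ₁ : ℝ → ℝ}
    (h₀ : ∀ t, HasDerivAt θ (θ₁ t) t)
    (h₁ : ∀ t, HasDerivAt θ₁
      (profileForce γ k A B (θ t) - 2 * μ * s / k ^ 2 * θ₁ t) t) {ε : ℝ} (hε : ε ≠ 0) :
    IsSolution γ μ k ε (travelingWave s ε fun y => Real.exp (θ y))
      (travelingWave s ε fun y => s * Real.exp (θ y) - A) := by
  set θ₂ : ℝ → ℝ := fun t => profileForce γ k A B (θ t) - 2 * μ * s / k ^ 2 * θ₁ t with hθ₂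
  have h₂ := fun t => ((hasDerivAt_profileForce γ k A B (θ t)).comp t (h₀ t)).sub
    ((h₁ t).const_mul (2 * μ * s / k ^ 2))
  set θ₃ : ℝ → ℝ := fun t => 2 / k ^ 2 * (-Real.exp (-θ t) * (Real.exp (γ * θ t) +
    A ^ 2 * Real.exp (-θ t) - B) + Real.exp (-θ t) * (γ * Real.exp (γ * θ t) -
    A ^ 2 * Real.exp (-θ t))) * θ₁ t - 2 * μ * s / k ^ 2 * θ₂ t with hθ₃
  replace h₂ : ∀ t, HasDerivAt θ₂ (θ₃ t) t := h₂
  -- Bootstrap: continuity of `θ₂` gives `θ` of class `C²`, hence `θ₂` of class `C¹` and `θ` of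
  -- class `C³`.
  have hθc : ContDiff ℝ 3 θ := by
    have c0 : ContDiff ℝ (0 : ℕ) θ₁ :=
      contDiff_zero.2 (continuous_iff_continuousAt.2 fun t => (h₁ t).continuousAt)
    have c1 : ContDiff ℝ (0 : ℕ) θ₂ :=
      contDiff_zero.2 (continuous_iff_continuousAt.2 fun t => (h₂ t).continuousAt)
    have c2 := contDiff_succ_of_hasDerivAt h₁ c1
    have c3 := contDiff_succ_of_hasDerivAt h₀ c2
    have c4 : ContDiff ℝ (1 : ℕ) θ₂ :=
      ((contDiff_profileForce γ k A B).comp (c3.of_le (by norm_num))).sub (contDiff_const.mul c2)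
    exact contDiff_succ_of_hasDerivAt h₀ (contDiff_succ_of_hasDerivAt h₁ c4)
  have hlin : ContDiff ℝ 3 (fun z : ℝ × ℝ => (z.2 - s * z.1) / ε) := by fun_prop
  have hρc : ContDiff ℝ 3 (fun z : ℝ × ℝ => Real.exp (θ ((z.2 - s * z.1) / ε))) :=
    (hθc.comp hlin).exp
  have hP : ∀ y, HasDerivAt (fun y => Real.exp (θ y)) (Real.exp (θ y) * θ₁ y) y :=
    fun y => (h₀ y).exp
  have hJ : ∀ y, HasDerivAt (fun y => s * Real.exp (θ y) - A) (s * (Real.exp (θ y) * θ₁ y)) y :=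
    fun y => ((hP y).const_mul s).sub_const A
  have hJ' : ∀ y, HasDerivAt (fun y => s * (Real.exp (θ y) * θ₁ y) / ε)
      (s * (Real.exp (θ y) * θ₁ y * θ₁ y + Real.exp (θ y) * θ₂ y) / ε) y :=
    fun y => (((hP y).mul (h₁ y)).const_mul s).div_const ε
  have hflux : (fun τ y => (travelingWave s ε (fun y => s * Real.exp (θ y) - A) τ y) ^ 2 /
        travelingWave s ε (fun y => Real.exp (θ y)) τ y +
        pressure γ (travelingWave s ε (fun y => Real.exp (θ y)) τ y)) =
      travelingWave s ε fun y => s ^ 2 * Real.exp (θ y) - 2 * s * A + A ^ 2 * Real.exp (-θ y) +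
        Real.exp (γ * θ y) := by
    funext τ y
    simp only [travelingWave, pressure]
    rw [mul_comm γ, Real.exp_mul, Real.exp_neg]
    have := Real.exp_pos (θ ((y - s * τ) / ε))
    field_simp
    ring
  have hflux' : ∀ y, HasDerivAt (fun y => s ^ 2 * Real.exp (θ y) - 2 * s * A +
      A ^ 2 * Real.exp (-θ y) + Real.exp (γ * θ y))
      (s ^ 2 * (Real.exp (θ y) * θ₁ y) + A ^ 2 * (Real.exp (-θ y) * -θ₁ y) +
        Real.exp (γ * θ y) * (γ * θ₁ y)) y := fun y =>
    ((((hP y).const_mul (s ^ 2)).sub_const _).add ((h₀ y).neg.exp.const_mul (A ^ 2))).add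
      ((h₀ y).const_mul γ).exp
  have hsqrt : (fun τ y => √(travelingWave s ε (fun y => Real.exp (θ y)) τ y)) =
      travelingWave s ε fun y => Real.exp (θ y / 2) := by
    funext τ y
    simp only [travelingWave]
    rw [Real.exp_half]
  have hs1 : ∀ y, HasDerivAt (fun y => Real.exp (θ y / 2)) (Real.exp (θ y / 2) * (θ₁ y / 2)) y :=
    fun y => ((h₀ y).div_const 2).exp
  have hs2 : ∀ y, HasDerivAt (fun y => Real.exp (θ y / 2) * (θ₁ y / 2) / ε)
      ((Real.exp (θ y / 2) * (θ₁ y / 2) * (θ₁ y / 2) + Real.exp (θ y / 2) * (θ₂ y / 2)) / ε) y :=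
    fun y => ((hs1 y).mul ((h₁ y).div_const 2)).div_const ε
  have hbohm : bohm (travelingWave s ε fun y => Real.exp (θ y)) =
      travelingWave s ε fun y => (θ₁ y ^ 2 / 4 + θ₂ y / 2) / ε ^ 2 := by
    funext t x
    have h1 : √(travelingWave s ε (fun y => Real.exp (θ y)) t x) =
        Real.exp (θ ((x - s * t) / ε) / 2) := congrFun (congrFun hsqrt t) x
    rw [bohm, h1, hsqrt, dx_travelingWave hs1, dx_travelingWave hs2]
    simp only [travelingWave]
    have := Real.exp_pos (θ ((x - s * t) / ε) / 2)
    field_simp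
    ring
  have hbohm' : ∀ y, HasDerivAt (fun y => (θ₁ y ^ 2 / 4 + θ₂ y / 2) / ε ^ 2)
      ((2 * θ₁ y * θ₂ y / 4 + θ₃ y / 2) / ε ^ 2) y := fun y =>
    (((((h₁ y).pow 2).div_const 4).add ((h₂ y).div_const 2)).div_const (ε ^ 2)).congr_deriv
      (by simp [hθ₂])
  refine ⟨hρc, (contDiff_const.mul (hρc.of_le (by norm_num))).sub contDiff_const,
    fun t x => Real.exp_pos _, fun t x => ?_, fun t x => ?_⟩
  · rw [dt_travelingWave hP, dx_travelingWave hJ]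
    simp only [travelingWave]
    ring
  · rw [hflux, dt_travelingWave hJ, dx_travelingWave hflux', dx_travelingWave hJ,
      dx_travelingWave hJ', hbohm, dx_travelingWave hbohm']
    simp only [travelingWave]
    generalize (x - s * t) / ε = y
    have e1 : Real.exp (θ y) * Real.exp (-θ y) = 1 := by rw [← Real.exp_add]; simp
    have e2 : θ₃ y = 2 / k ^ 2 * (-Real.exp (-θ y) * (Real.exp (γ * θ y) +
      A ^ 2 * Real.exp (-θ y) - B) + Real.exp (-θ y) * (γ * Real.exp (γ * θ y) -
      A ^ 2 * Real.exp (-θ y))) * θ₁ y - 2 * μ * s / k ^ 2 * θ₂ y := rfl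
    have e3 : θ₂ y = 2 / k ^ 2 * (Real.exp (-θ y) * (Real.exp (γ * θ y) +
      A ^ 2 * Real.exp (-θ y) - B)) - 2 * μ * s / k ^ 2 * θ₁ y := rfl
    generalize Real.exp (θ y) = e at *
    generalize Real.exp (-θ y) = i at *
    generalize Real.exp (γ * θ y) = p at *
    generalize θ₃ y = q at *
    generalize θ₂ y = r at *
    generalize θ₁ y = v at *
    -- The once-differentiated oscillator equation, free of `B`.
    have e4 : k ^ 2 * e * (q + v * r) =
        2 * (γ * p - A ^ 2 * i) * v - 2 * μ * s * e * (r + v ^ 2) := by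
      have e5 : k ^ 2 * q = 2 * (-i * (p + A ^ 2 * i - B) + i * (γ * p - A ^ 2 * i)) * v
          - 2 * μ * s * r := by
        rw [e2]; field_simp
      have e6 : k ^ 2 * r = 2 * (i * (p + A ^ 2 * i - B)) - 2 * μ * s * v := by
        rw [e3]; field_simp
      linear_combination e * e5 + e * v * e6 + 2 * (γ * p - A ^ 2 * i) * v * e1
    field_simp
    linear_combination -4 * e4

/-! ### Sign of the force and the logarithmic density profile. -/

theorem strictConvexOn_exp_mul_add_exp_neg {γ : ℝ} (hγ : γ ≠ 0) (A B : ℝ) :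
    StrictConvexOn ℝ univ
      (fun x : ℝ => Real.exp (γ * x) + A ^ 2 * Real.exp (-x) - B) := by
  have h1 : ∀ x : ℝ, HasDerivAt (fun x => Real.exp (-x)) (-Real.exp (-x)) x := fun x => by
    simpa using (hasDerivAt_neg x).exp
  have h2 : ∀ x : ℝ, HasDerivAt (fun x => Real.exp (γ * x)) (γ * Real.exp (γ * x)) x := fun x => by
    simpa [mul_comm] using ((hasDerivAt_id x).const_mul γ).exp
  have h3 : deriv (fun x : ℝ => Real.exp (γ * x) + A ^ 2 * Real.exp (-x) - B) =
      fun x => γ * Real.exp (γ * x) + A ^ 2 * -Real.exp (-x) :=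
    funext fun x => (((h2 x).add ((h1 x).const_mul (A ^ 2))).sub_const B).deriv
  have h4 : deriv (fun x : ℝ => γ * Real.exp (γ * x) + A ^ 2 * -Real.exp (-x)) =
      fun x => γ * (γ * Real.exp (γ * x)) + A ^ 2 * - -Real.exp (-x) :=
    funext fun x => (((h2 x).const_mul γ).add ((h1 x).neg.const_mul (A ^ 2))).deriv
  refine strictConvexOn_univ_of_deriv2_pos (by fun_prop) fun x => ?_
  rw [Function.iterate_succ, Function.iterate_one, Function.comp_apply, h3, h4]
  have : 0 < γ ^ 2 * Real.exp (γ * x) := by positivity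
  have : 0 ≤ A ^ 2 * Real.exp (-x) := by positivity
  linarith

/-- As the density tends to zero the term `A ^ 2 * exp (-x)` dominates, which needs `A ≠ 0`. The
threshold makes the bracket at least `1` and the prefactor `exp (-x)` at least `k ^ 2`. -/
theorem one_le_profileForce {γ k A : ℝ} (B : ℝ) (hk : k ≠ 0) (hA : A ≠ 0) {x : ℝ}
    (hx : x ≤ -((|B| + 1) / A ^ 2 + k ^ 2)) : 1 ≤ profileForce γ k A B x := by
  have hA2 : 0 < A ^ 2 := by positivity
  have hk2 : 0 < k ^ 2 := by positivity
  have h0 : 0 < (|B| + 1) / A ^ 2 := by positivity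
  have h1 := Real.add_one_le_exp (-x)
  have h2 : (|B| + 1) / A ^ 2 ≤ Real.exp (-x) := by linarith
  rw [div_le_iff₀ hA2] at h2
  have h3 : k ^ 2 ≤ Real.exp (-x) := by linarith
  have h4 := Real.exp_pos (γ * x)
  have h5 : 1 ≤ Real.exp (γ * x) + A ^ 2 * Real.exp (-x) - B := by linarith [le_abs_self B]
  have h6 : k ^ 2 * 1 ≤ Real.exp (-x) * (Real.exp (γ * x) + A ^ 2 * Real.exp (-x) - B) := by gcongr
  rw [profileForce, div_mul_eq_mul_div, le_div_iff₀ hk2]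
  linarith

/-- The heteroclinic orbit, for the logarithm of the density, from a saddle with density `Ps` to a
sink with lower density `Pn`. -/
theorem exists_log_density_profile {γ k A B d Ps Pn : ℝ} (hγ : 1 ≤ γ) (hk : k ≠ 0) (hA : A ≠ 0)
    (hd : 0 < d) (hPn : 0 < Pn) (hlt : Pn < Ps) (hs : pressure γ Ps + A ^ 2 / Ps = B)
    (hn : pressure γ Pn + A ^ 2 / Pn = B) :
    ∃ φ v : ℝ → ℝ, (∀ t, HasDerivAt φ (v t) t) ∧
      (∀ t, HasDerivAt v (profileForce γ k A B (φ t) - d * v t) t) ∧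
      Tendsto φ atBot (𝓝 (Real.log Ps)) ∧ Tendsto φ atTop (𝓝 (Real.log Pn)) ∧
      Tendsto v atBot (𝓝 0) ∧ Tendsto v atTop (𝓝 0) := by
  have hPs : 0 < Ps := hPn.trans hlt
  have hba := Real.log_lt_log hPn hlt
  have hzero : ∀ P, 0 < P → pressure γ P + A ^ 2 / P = B →
      Real.exp (γ * Real.log P) + A ^ 2 * Real.exp (-Real.log P) - B = 0 := fun P hP h => by
    rw [mul_comm γ, Real.exp_mul, Real.exp_neg, Real.exp_log hP, ← h, pressure]
    ring
  have hconv := strictConvexOn_exp_mul_add_exp_neg (γ := γ) (by linarith) A B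
  have hfac : ∀ x : ℝ, 0 < 2 / k ^ 2 * Real.exp (-x) := fun x => by positivity
  refine exists_heteroclinic (contDiff_profileForce γ k A B) hd hba ?_ (fun x hx => ?_)
    (fun x hx => ?_) (fun x hx => one_le_profileForce B hk hA hx)
  · rw [profileForce, hzero Ps hPs hs]
    simp
  · have := hconv.lt_on_openSegment (mem_univ _) (mem_univ _) hba.ne
      (by rwa [openSegment_eq_Ioo hba])
    rw [hzero Ps hPs hs, hzero Pn hPn hn, max_self] at this
    rw [profileForce, ← mul_assoc]
    exact mul_neg_of_pos_of_neg (hfac x) this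
  · have := hconv.lt_on_openSegment (mem_univ x) (mem_univ (Real.log Ps)) (hx.trans hba).ne
      (z := Real.log Pn) (by rw [openSegment_eq_Ioo (hx.trans hba)]; exact ⟨hx, hba⟩)
    rw [hzero Ps hPs hs, hzero Pn hPn hn, lt_max_iff, or_iff_left (lt_irrefl _)] at this
    rw [profileForce, ← mul_assoc]
    exact mul_pos (hfac x) this

theorem isTravelingWaveProfile_exp {γ μ k s A B Pm Jm Pp Jp : ℝ} (hk : k ≠ 0) (hPm : 0 < Pm)
    (hPp : 0 < Pp) (hJm : Jm = s * Pm - A) (hJp : Jp = s * Pp - A) {θ θ₁ : ℝ → ℝ}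
    (h₀ : ∀ t, HasDerivAt θ (θ₁ t) t)
    (h₁ : ∀ t, HasDerivAt θ₁ (profileForce γ k A B (θ t) - 2 * μ * s / k ^ 2 * θ₁ t) t)
    (hm : Tendsto θ atBot (𝓝 (Real.log Pm))) (hp : Tendsto θ atTop (𝓝 (Real.log Pp)))
    (hm₁ : Tendsto θ₁ atBot (𝓝 0)) (hp₁ : Tendsto θ₁ atTop (𝓝 0)) :
    IsTravelingWaveProfile γ μ k s (Pm, Jm) (Pp, Jp) (fun y => Real.exp (θ y))
      (fun y => s * Real.exp (θ y) - A) := by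
  have em := (Real.continuous_exp.tendsto _).comp hm
  have ep := (Real.continuous_exp.tendsto _).comp hp
  rw [Real.exp_log hPm] at em
  rw [Real.exp_log hPp] at ep
  have hderiv : deriv (fun y => Real.exp (θ y)) = fun y => Real.exp (θ y) * θ₁ y :=
    funext fun y => (h₀ y).exp.deriv
  refine ⟨fun ε hε => isSolution_of_profile hk h₀ h₁ hε.ne', em, ep, ?_, ?_, ?_, ?_⟩
  · rw [hJm]
    exact (em.const_mul s).sub_const A
  · rw [hJp]
    exact (ep.const_mul s).sub_const A
  · rw [hderiv]
    simpa using em.mul hm₁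
  · rw [hderiv]
    simpa using ep.mul hp₁

/-! ### Lax and subsonic conditions. -/

theorem soundSpeed_mono {γ P Q : ℝ} (hγ : 1 ≤ γ) (hP : 0 < P) (h : P ≤ Q) :
    soundSpeed γ P ≤ soundSpeed γ Q := by
  unfold soundSpeed
  have := Real.rpow_le_rpow hP.le h (show 0 ≤ γ - 1 by linarith)
  gcongr

/-- If the relative mass flux `A` is supersonic at `P` and subsonic at `Q`, then `P < Q`. -/
theorem lt_of_flux_soundSpeed {γ A P Q : ℝ} (hγ : 1 ≤ γ) (hP : 0 < P) (hQ : 0 < Q)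
    (h1 : soundSpeed γ P < A / P) (h2 : A / Q < soundSpeed γ Q) : 0 < A ∧ P < Q := by
  have hA : 0 < A := by
    have := (Real.sqrt_nonneg _ : 0 ≤ soundSpeed γ P).trans_lt h1
    rwa [div_pos_iff_of_pos_right hP] at this
  refine ⟨hA, ?_⟩
  by_contra hle
  rw [not_lt] at hle
  have h3 := soundSpeed_mono hγ hQ hle
  have h4 : A / P ≤ A / Q := by gcongr
  linarith

/-- The integrated momentum equation has the same constant at both end states. -/
theorem RankineHugoniot.integrated {γ s Pm Jm Pp Jp A : ℝ} (hPm : Pm ≠ 0) (hPp : Pp ≠ 0)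
    (h : RankineHugoniot γ s (Pm, Jm) (Pp, Jp)) (hA : A = s * Pm - Jm) :
    Jm = s * Pm - A ∧ Jp = s * Pp - A ∧
      pressure γ Pp + A ^ 2 / Pp = pressure γ Pm + A ^ 2 / Pm := by
  have h1 : Jp - Jm = s * (Pp - Pm) := h.mass
  have h2 : Jp ^ 2 / Pp + pressure γ Pp - (Jm ^ 2 / Pm + pressure γ Pm) = s * (Jp - Jm) :=
    h.momentum
  have hJm : Jm = s * Pm - A := by linarith
  have hJp : Jp = s * Pp - A := by linarith
  have h3 : ∀ P : ℝ, P ≠ 0 → (s * P - A) ^ 2 / P = s ^ 2 * P - 2 * s * A + A ^ 2 / P :=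
    fun P hP => by field_simp; ring
  refine ⟨hJm, hJp, ?_⟩
  rw [hJm, hJp, h3 _ hPm, h3 _ hPp] at h2
  linarith

end QHD

open QHD in
theorem mainTheorem2 (γ μ k : ℝ) (hγ : 1 ≤ γ) (hμ : 0 < μ) (hk : 0 < k)
    (s Pm Jm Pp Jp : ℝ) (hPm : 0 < Pm) (hPp : 0 < Pp)
    (hshock :
      (QHD.IsLax2Shock γ s (Pm, Jm) (Pp, Jp) ∧ QHD.IsSubsonic γ (Pp, Jp)) ∨
      (QHD.IsLax1Shock γ s (Pm, Jm) (Pp, Jp) ∧ QHD.IsSubsonic γ (Pm, Jm))) :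
    ∃ P J : ℝ → ℝ, QHD.IsTravelingWaveProfile γ μ k s (Pm, Jm) (Pp, Jp) P J := by
  obtain ⟨A, hA⟩ : ∃ A, A = s * Pm - Jm := ⟨_, rfl⟩
  rcases hshock with ⟨⟨hRH, hr, hl⟩, hsub⟩ | ⟨⟨hRH, hr, hl⟩, hsub⟩
  all_goals
    obtain ⟨hJm, hJp, hB⟩ := hRH.integrated hPm.ne' hPp.ne' hA
    simp only [charSpeed₁, charSpeed₂, velocity, IsSubsonic] at hr hl hsub
    have hum : Jm / Pm = s - A / Pm := by rw [hJm]; field_simp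
    have hup : Jp / Pp = s - A / Pp := by rw [hJp]; field_simp
  -- Subsonicity on the right makes the second characteristic speed positive there, and `s` lies
  -- above it. The Lax inequalities then say that the flux is supersonic at `Pp` and subsonic at
  -- `Pm`.
  · have hs : 0 < s := by linarith [(abs_lt.1 hsub).1]
    rw [hup] at hr
    rw [hum] at hl
    obtain ⟨hA0, hlt⟩ := lt_of_flux_soundSpeed (A := A) hγ hPp hPm (by linarith) (by linarith)
    obtain ⟨φ, v, h₀, h₁, h⟩ := exists_log_density_profile (d := 2 * μ * s / k ^ 2) hγ hk.ne'
      hA0.ne' (by positivity) hPp hlt rfl hB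
    exact ⟨_, _, isTravelingWaveProfile_exp hk.ne' hPm hPp hJm hJp h₀ h₁ h.1 h.2.1 h.2.2.1
      h.2.2.2⟩
  -- Mirror case: `s` lies below a negative first characteristic speed, the flux `-A` is positive,
  -- and the smaller density is on the left.
  · have hs : s < 0 := by linarith [(abs_lt.1 hsub).2]
    rw [hup] at hr
    rw [hum] at hl
    obtain ⟨hA0, hlt⟩ := lt_of_flux_soundSpeed (A := -A) hγ hPm hPp
      (by rw [neg_div]; linarith) (by rw [neg_div]; linarith)
    have hd : 0 < 2 * μ * -s / k ^ 2 := by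
      have := neg_pos.2 hs
      positivity
    obtain ⟨φ, v, h₀, h₁, h⟩ := exists_log_density_profile hγ hk.ne'
      (neg_ne_zero.1 hA0.ne') hd hPm hlt hB rfl
    -- The friction is negative since `s < 0`; the orbit found for friction `2 * μ * -s / k ^ 2` is
    -- run backward, which swaps its limits.
    refine ⟨_, _, isTravelingWaveProfile_exp hk.ne' hPm hPp hJm hJp (B := pressure γ Pm + A ^ 2 / Pm)
      (θ := fun t => φ (-t)) (θ₁ := fun t => -v (-t)) (fun t => ?_) (fun t => ?_)
      (h.2.1.comp tendsto_neg_atBot_atTop) (h.1.comp tendsto_neg_atTop_atBot) ?_ ?_⟩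
    · exact ((h₀ (-t)).comp t (hasDerivAt_neg t)).congr_deriv (by ring)
    · exact ((h₁ (-t)).comp t (hasDerivAt_neg t)).neg.congr_deriv (by ring)
    · simpa using (h.2.2.2.comp tendsto_neg_atBot_atTop).neg
    · simpa using (h.2.2.1.comp tendsto_neg_atTop_atBot).neg
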